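/- Let $\mathcal H$ be a real Hilbert space, $N\ge 1$, and let $F_1,\dots,F_N:\mathcal H\to\mathcal H$ be nonexpansive operators with $X^*:=\bigcap_{i=1}^N \mathrm{Fix}(F_i)\neq\emptyset$. Write $d_{X^*}(y):=\inf_{z\in X^*}\|y-z\|$. Network: let $\mathcal G_k=([N],\mathcal E_k)$, $k\in\mathbb N=\{0,1,2,\dots\}$, be digraphs with weight matrices $A_k=(a_{ij,k})\in\mathbb R^{N\times N}$ such that $a_{ij,k}>0$ if $(j,i)\in\mathcal E_k$, $a_{ij,k}=0$ otherwise, and $a_{ii,k}>0$ for all $i,k$. Assume that there is an integer $Q>0$ such that $\bigcup_{l=1}^{Q}\mathcal G_{k+l}$ is strongly connected for every $k\ge 0$; that every $A_k$ is row-stochastic; and that there is $\underline a\in(0,1)$ such that $a_{ij,k}>\underline a$ whenever $a_{ij,k}>0$. Assume that $\{F_i\}$ is boundedly power regular: for every bounded $\Theta\subset\mathcal H$ there is $\kappa\ge 0$ with $d_{X^*}(y)\le\kappa\sum_{i=1}^N\|y-F_i(y)\|$ for all $y\in\Theta$. Let $\alpha\in(0,1/2]$ and $\alpha_{i,k}\in[\alpha,1-\alpha]$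 for all $i,k$, let $x_{1,0},\dots,x_{N,0}\in\mathcal H$ be arbitrary, and let $x_{i,k}$ be generated by the (error-free) D-KM iteration $$\hat x_{i,k}=\sum_{j=1}^N a_{ij,k}x_{j,k},\qquad x_{i,k+1}=\hat x_{i,k}+\alpha_{i,k}\big(F_i(\hat x_{i,k})-\hat x_{i,k}\big).$$ (a) There are vectors $\pi_k=(\pi_{1,k},\dots,\pi_{N,k})\in\mathbb R^N$ ($k\ge 0$) and constants $\underline\pi>0$, $\varpi>0$, $\xi\in(0,1)$ such that for all $k\ge0$: $\sum_i\pi_{i,k}=1$; $\pi_{i,k}\ge\underline\pi$ for all $i$; $\pi_k^\top=\pi_{k+1}^\top A_k$; and $|(A_{s-1}\cdots A_k)_{ij}-\pi_{j,k}|\le\varpi\,\xi^{s-k}$ for all $s\ge k$ and all $i,j$ (the empty product being the identity). Also, there are $\chi>0$ and $\kappa>0$ such that $\|x_{i,k}\|\le\chi$ for all $i,k$, and $d_{X^*}(y)\le\kappa\sum_{i=1}^N\|y-F_i(y)\|$ for all $y$ with $\|y\|\le\chi$. (b) For all $(\pi_k)_{k\ge0},\underline\pi,\varpi,\xi$ and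 $\chi,\kappa$ as in (a): if, with $K:=\sqrt N\,\kappa$ and $\alpha_c:=\sup_{i,k}\alpha_{i,k}$, $$\alpha_c<\min\Big\{\frac1{2K}\sqrt{\frac{\underline\pi}{2N\gamma_2}},\;1-\alpha\Big\},\qquad \gamma_2:=\frac{24N^3\varpi^2\xi^2}{(1-\xi)^2}\Big(2+\frac1{4NK^2}\Big),$$ then there is a point $x^*\in X^*$ such that, for every $i\in[N]$, $x_{i,k}\to x^*$ strongly and $\|x_{i,k}-x^*\|=O\big(1/k^{\ln(1/\xi)}\big)$ as $k\to\infty$. -/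

import Mathlib

open Filter Topology Asymptotics
open scoped Matrix

namespace DKM

/-- A digraph is strongly connected if there is a directed path from any node to any other. -/
def StronglyConnected {V : Type*} (G : Digraph V) : Prop :=
  ∀ i j : V, Relation.ReflTransGen G.Adj i j

/-- The sequence of digraphs `G k` is uniformly jointly strongly connected: for some `Q > 0`, the
union `G (k+1) ∪ ... ∪ G (k+Q)` is strongly connected for every `k ≥ 0`. -/
def UniformlyJointlyStronglyConnected {V : Type*} (G : ℕ → Digraph V) : Prop :=
  ∃ Q : ℕ, 0 < Q ∧ ∀ k : ℕ, StronglyConnected (⨆ l : Set.Icc 1 Q, G (k + (l : ℕ)))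

/-- `A k` are adjacency matrices of the time-varying digraphs `G k`, with positive diagonals:
the weight `A k i j` that agent `i` gives to agent `j` is positive if `(j, i)` is an edge of `G k`
and is zero otherwise. -/
structure IsWeightSequence {N : ℕ} (G : ℕ → Digraph (Fin N))
    (A : ℕ → Matrix (Fin N) (Fin N) ℝ) : Prop where
  pos_of_adj : ∀ k i j, (G k).Adj j i → 0 < A k i j
  eq_zero_of_not_adj : ∀ k i j, ¬ (G k).Adj j i → A k i j = 0
  diag_pos : ∀ k i, 0 < A k i i

/-- Graph connectivity and weights rule. -/
structure NetworkAssumption {N : ℕ} (G : ℕ → Digraph (Fin N))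
    (A : ℕ → Matrix (Fin N) (Fin N) ℝ) : Prop where
  weights : IsWeightSequence G A
  connected : UniformlyJointlyStronglyConnected G
  row_sum : ∀ k i, ∑ j, A k i j = 1
  lower_bound : ∃ a : ℝ, 0 < a ∧ a < 1 ∧ ∀ k i j, 0 < A k i j → a < A k i j

/-- `transition A k n` is the product `A (k+n-1) * ... * A k` of `n` consecutive weight matrices
starting at time `k` (the identity for `n = 0`). -/
def transition {N : ℕ} (A : ℕ → Matrix (Fin N) (Fin N) ℝ) (k : ℕ) :
    ℕ → Matrix (Fin N) (Fin N) ℝ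
  | 0 => 1
  | n + 1 => A (k + n) * transition A k n

variable {H : Type*} [NormedAddCommGroup H] [InnerProductSpace ℝ H]

/-- The set of common fixed points of the family `F`. -/
def commonFix {ι : Type*} (F : ι → H → H) : Set H :=
  ⋂ i, Function.fixedPoints (F i)

/-- Bounded power regularity of a finite family of operators with a common fixed point. -/
def BoundedlyPowerRegular {ι : Type*} [Fintype ι] (F : ι → H → H) : Prop :=
  (commonFix F).Nonempty ∧
    ∀ S : Set H, Bornology.IsBounded S →
      ∃ κ : ℝ, 0 ≤ κ ∧ ∀ x ∈ S, Metric.infDist x (commonFix F) ≤ κ * ∑ i, ‖x - F i x‖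

/-- The aggregate `∑ j, A k i j • x k j` received by agent `i` at time `k`. -/
def aggregate {N : ℕ} (A : ℕ → Matrix (Fin N) (Fin N) ℝ) (x : ℕ → Fin N → H)
    (k : ℕ) (i : Fin N) : H :=
  ∑ j, A k i j • x k j

/-- `x` is generated by the distributed inexact Krasnosel'skii-Mann iteration with operators `F`,
weights `A`, relaxation parameters `αs` and errors `ε`. -/
def IsDIKM {N : ℕ} (F : Fin N → H → H) (A : ℕ → Matrix (Fin N) (Fin N) ℝ)
    (αs : ℕ → Fin N → ℝ) (ε : ℕ → Fin N → H) (x : ℕ → Fin N → H) : Prop :=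
  ∀ k i, x (k + 1) i =
    aggregate A x k i + αs k i • (F i (aggregate A x k i) + ε k i - aggregate A x k i)

/-- `x` is generated by the error-free iteration (D-KM). -/
def IsDKM {N : ℕ} (F : Fin N → H → H) (A : ℕ → Matrix (Fin N) (Fin N) ℝ)
    (αs : ℕ → Fin N → ℝ) (x : ℕ → Fin N → H) : Prop :=
  IsDIKM F A αs (fun _ _ => 0) x

/-- Mixing data of the weight matrices: stochastic vectors `p k`, bounded below by `pmin > 0`,
with `p k = p (k+1) * A k`, to which the rows of the transition matrices converge
geometrically, with constants `ϖ > 0` and `ξ ∈ (0,1)`. -/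
structure IsMixing {N : ℕ} (A : ℕ → Matrix (Fin N) (Fin N) ℝ)
    (p : ℕ → Fin N → ℝ) (pmin ϖ ξ : ℝ) : Prop where
  sum_eq_one : ∀ k, ∑ i, p k i = 1
  ϖ_pos : 0 < ϖ
  ξ_pos : 0 < ξ
  ξ_lt_one : ξ < 1
  mixing : ∀ k n i j, |transition A k n i j - p k j| ≤ ϖ * ξ ^ n
  pmin_pos : 0 < pmin
  pmin_le : ∀ k i, pmin ≤ p k i
  backward : ∀ k, p k = p (k + 1) ᵥ* A k

/-- `κ > 0` is a constant of power regularity of `F` on the ball `B(0; χ)`, where `χ` bounds all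
iterates `x k i`. -/
structure IsRegularityConstant {N : ℕ} (F : Fin N → H → H) (x : ℕ → Fin N → H)
    (χ κ : ℝ) : Prop where
  χ_pos : 0 < χ
  norm_le : ∀ k i, ‖x k i‖ ≤ χ
  κ_pos : 0 < κ
  regular : ∀ y ∈ Metric.closedBall (0 : H) χ,
    Metric.infDist y (commonFix F) ≤ κ * ∑ i, ‖y - F i y‖

/-- `γ₂ = 24 N³ ϖ² ξ² / (1 - ξ)² * (2 + 1 / (4 N K²))`. -/
noncomputable def gamma₂ (N : ℕ) (ϖ ξ K : ℝ) : ℝ :=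
  24 * (N : ℝ) ^ 3 * ϖ ^ 2 * ξ ^ 2 / (1 - ξ) ^ 2 * (2 + 1 / (4 * N * K ^ 2))

/-- The largest relaxation parameter (as a supremum). -/
noncomputable def maxRelaxation {N : ℕ} (αs : ℕ → Fin N → ℝ) : ℝ :=
  ⨆ q : ℕ × Fin N, αs q.1 q.2

/-- The step-size condition
`α_c < min {1 / (2 K) * √(pmin / (2 N γ₂)), 1 - α}`, where `K` is a constant with
`d(y, X*)² ≤ K² ∑ i, ‖F i y - y‖²` on the relevant ball. -/
def StepCondition {N : ℕ} (αs : ℕ → Fin N → ℝ) (α pmin ϖ ξ K : ℝ) : Prop :=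
  maxRelaxation αs <
    min (1 / (2 * K) * Real.sqrt (pmin / (2 * N * gamma₂ N ϖ ξ K))) (1 - α)

end DKM

/-! Mixing: self-loops keep influence alive, and each round of joint connectivity enlarges the set
of agents that a given state has reached, so products over a fixed window have entries at least `η >
0`. Such a product shrinks the spread of every column by `1 - η`; hence the rows of the transition
matrices approach a common limit `p k`, which inherits the lower bound and the backward relation.

Convergence: let W be the infimum over `z` in X* of the `p k`-weighted squared distance to `z`, E
the squared disagreement, and D the sum of squared residuals over a window of suitable length L. The
backward relation makes the weighted distance to every `z` decrease, so W drops by at least c D.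
Mixing gives E' ≤ E/2 + C D, and bounded regularity gives W ≤ B (E + D). Hence some combination sW +
δE contracts by a fixed factor per window (`exists_lyapunov_weights`), and W decays geometrically.
By Fejér monotonicity a near-minimizer at time `k` stays close to all later states, so the states
converge to a point of X* at a geometric rate, which beats every power of 1/k. -/

namespace DKM

/-! ### Products of stochastic matrices and absolute probability sequences -/

section Transition

variable {N : ℕ} {A : ℕ → Matrix (Fin N) (Fin N) ℝ}

theorem transition_add (A : ℕ → Matrix (Fin N) (Fin N) ℝ) (k m n : ℕ) :
    transition A k (m + n) = transition A (k + m) n * transition A k m := by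
  induction n with
  | zero => simp [transition]
  | succ n ih =>
    rw [← add_assoc, transition, ih, transition, Matrix.mul_assoc, add_assoc]

theorem transition_nonneg (hA : ∀ k i j, 0 ≤ A k i j) (k n : ℕ) (i j : Fin N) :
    0 ≤ transition A k n i j := by
  induction n generalizing i with
  | zero => rw [transition, Matrix.one_apply]; split_ifs <;> norm_num
  | succ n ih =>
    rw [transition, Matrix.mul_apply]
    exact Finset.sum_nonneg fun l _ => mul_nonneg (hA _ _ _) (ih l)

theorem transition_row_sum (hA : ∀ k i, ∑ j, A k i j = 1) (k n : ℕ) (i : Fin N) :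
    ∑ j, transition A k n i j = 1 := by
  induction n generalizing i with
  | zero => simp [transition, Matrix.one_apply]
  | succ n ih =>
    simp only [transition, Matrix.mul_apply]
    rw [Finset.sum_comm]
    simp only [← Finset.mul_sum, ih, mul_one, hA]

theorem mul_le_transition_succ (hA : ∀ k i j, 0 ≤ A k i j) (k n : ℕ) (i l j : Fin N) :
    A (k + n) i l * transition A k n l j ≤ transition A k (n + 1) i j := by
  rw [transition, Matrix.mul_apply]
  exact Finset.single_le_sum
    (f := fun l => A (k + n) i l * transition A k n l j)
    (fun l _ => mul_nonneg (hA _ _ _) (transition_nonneg hA _ _ _ _)) (Finset.mem_univ l)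

/-- A positive entry contains a positive path product, each of whose factors is at least `a`;
uniform lower bounds thus reduce to positivity. -/
theorem pow_le_transition_of_pos (hA : ∀ k i j, 0 ≤ A k i j) {a : ℝ} (ha0 : 0 ≤ a)
    (ha : ∀ k i j, 0 < A k i j → a ≤ A k i j) (k n : ℕ) (i j : Fin N)
    (h : 0 < transition A k n i j) : a ^ n ≤ transition A k n i j := by
  induction n generalizing i with
  | zero =>
    rw [transition, Matrix.one_apply] at h ⊢
    split_ifs at h ⊢ <;> simp_all
  | succ n ih =>
    have hl : ∃ l, 0 < A (k + n) i l * transition A k n l j := by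
      by_contra! hcon
      rw [transition, Matrix.mul_apply] at h
      exact absurd h (not_lt.mpr (Finset.sum_nonpos fun l _ => hcon l))
    obtain ⟨l, hl⟩ := hl
    have h1 : 0 < A (k + n) i l := pos_of_mul_pos_left hl (transition_nonneg hA _ _ _ _)
    have h2 : 0 < transition A k n l j := pos_of_mul_pos_right hl h1.le
    calc a ^ (n + 1) = a * a ^ n := pow_succ' a n
      _ ≤ A (k + n) i l * transition A k n l j :=
        mul_le_mul (ha _ _ _ h1) (ih l h2) (pow_nonneg ha0 _) h1.le
      _ ≤ _ := mul_le_transition_succ hA k n i l j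

theorem transition_pos_mono (hA : ∀ k i j, 0 ≤ A k i j) (hd : ∀ k i, 0 < A k i i)
    (k : ℕ) {m n : ℕ} (hmn : m ≤ n) (i j : Fin N) (h : 0 < transition A k m i j) :
    0 < transition A k n i j := by
  induction n, hmn using Nat.le_induction with
  | base => exact h
  | succ n _ ih =>
    exact (mul_pos (hd (k + n) i) ih).trans_le (mul_le_transition_succ hA k n i i j)

/-- A path from inside a set to its outside traverses an edge that leaves the set. -/
theorem exists_leaving_edge {V : Type*} {r : V → V → Prop} {s : Set V} {u v : V}
    (h : Relation.ReflTransGen r u v) (hu : u ∈ s) (hv : v ∉ s) :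
    ∃ b ∈ s, ∃ c ∉ s, r b c := by
  induction h with
  | refl => exact absurd hu hv
  | @tail b c _ hbc ih =>
    by_cases hb : b ∈ s
    · exact ⟨b, hb, c, hv, hbc⟩
    · exact ih hb

open Classical in
/-- After `n` rounds of joint connectivity, the state of `j` at time `k` has influenced at least
`min N (n + 1)` agents. -/
theorem le_card_reached {G : ℕ → Digraph (Fin N)} (hA : IsWeightSequence G A)
    (hA0 : ∀ k i j, 0 ≤ A k i j) {Q : ℕ}
    (hQ : ∀ k : ℕ, StronglyConnected (⨆ l : Set.Icc 1 Q, G (k + (l : ℕ))))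
    (k : ℕ) (j : Fin N) (n : ℕ) :
    min N (n + 1) ≤
      (Finset.univ.filter fun i => 0 < transition A k (n * (Q + 1)) i j).card := by
  induction n with
  | zero =>
    refine (min_le_right _ _).trans ?_
    rw [zero_add, Nat.one_le_iff_ne_zero, ← Nat.pos_iff_ne_zero, Finset.card_pos]
    exact ⟨j, by simp [transition]⟩
  | succ n ih =>
    have hsub : (Finset.univ.filter fun i => 0 < transition A k (n * (Q + 1)) i j) ⊆
        Finset.univ.filter fun i => 0 < transition A k ((n + 1) * (Q + 1)) i j := by
      intro i hi
      simp only [Finset.mem_filter, Finset.mem_univ, true_and] at hi ⊢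
      exact transition_pos_mono hA0 hA.diag_pos k (Nat.mul_le_mul_right _ n.le_succ) i j hi
    by_cases hall : ∀ i, 0 < transition A k (n * (Q + 1)) i j
    · refine (min_le_left _ _).trans (le_trans ?_ (Finset.card_le_card hsub))
      rw [Finset.filter_true_of_mem fun i _ => hall i]
      simp
    -- A path from `j` to an unreached `v` in the joint graph must leave the reached set, which adds
    -- a new agent `c`.
    · push Not at hall
      obtain ⟨v, hv⟩ := hall
      have hj : 0 < transition A k (n * (Q + 1)) j j :=
        transition_pos_mono hA0 hA.diag_pos k (Nat.zero_le _) j j (by simp [transition])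
      obtain ⟨b, hb, c, hc, hbc⟩ := exists_leaving_edge
        (s := {i | 0 < transition A k (n * (Q + 1)) i j})
        (hQ (k + n * (Q + 1)) j v) hj (not_lt.mpr hv)
      rw [Digraph.iSup_adj] at hbc
      obtain ⟨⟨l, hl1, hlQ⟩, hadj⟩ := hbc
      have hbl := transition_pos_mono hA0 hA.diag_pos k
        (Nat.le_add_right (n * (Q + 1)) l) b j hb
      -- The edge is active at offset `l ≤ Q`, so its matrix enters only the product of length `l +
      -- 1`; hence rounds of length `Q + 1`.
      have hcl : 0 < transition A k (n * (Q + 1) + l + 1) c j := by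
        refine lt_of_lt_of_le (mul_pos ?_ hbl) (mul_le_transition_succ hA0 k _ c b j)
        rw [← add_assoc]
        exact hA.pos_of_adj _ _ _ hadj
      have hc' := transition_pos_mono hA0 hA.diag_pos k
        (show n * (Q + 1) + l + 1 ≤ (n + 1) * (Q + 1) by nlinarith) c j hcl
      have hlt := Finset.card_lt_card (Finset.ssubset_iff_of_subset hsub |>.mpr
        ⟨c, by simpa using hc', by simpa using hc⟩)
      omega

theorem NetworkAssumption.nonneg {G : ℕ → Digraph (Fin N)} (h : NetworkAssumption G A)
    (k : ℕ) (i j : Fin N) : 0 ≤ A k i j := by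
  by_cases hadj : (G k).Adj j i
  · exact (h.weights.pos_of_adj k i j hadj).le
  · exact (h.weights.eq_zero_of_not_adj k i j hadj).ge

/-- Transition matrices over windows of a fixed length have uniformly positive entries. -/
theorem NetworkAssumption.exists_uniform_positive {G : ℕ → Digraph (Fin N)}
    (h : NetworkAssumption G A) (hN : 0 < N) :
    ∃ L : ℕ, 0 < L ∧ ∃ η : ℝ, 0 < η ∧ η < 1 ∧ ∀ k i j, η ≤ transition A k L i j := by
  classical
  obtain ⟨Q, -, hQ⟩ := h.connected
  obtain ⟨a, ha0, ha1, ha⟩ := h.lower_bound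
  have hL : N * (Q + 1) ≠ 0 := by positivity
  refine ⟨N * (Q + 1), Nat.pos_of_ne_zero hL, a ^ (N * (Q + 1)), pow_pos ha0 _,
    pow_lt_one₀ ha0.le ha1 hL, fun k i j => ?_⟩
  refine pow_le_transition_of_pos h.nonneg ha0.le (fun k i j hp => (ha k i j hp).le) k _ i j ?_
  have hcard := le_card_reached h.weights h.nonneg hQ k j N
  rw [min_eq_left (Nat.le_succ N)] at hcard
  have hu := Finset.eq_univ_of_card _
    (le_antisymm (Finset.card_le_univ _) ((Fintype.card_fin N).trans_le hcard))
  have hi : i ∈ Finset.univ.filter fun i => 0 < transition A k (N * (Q + 1)) i j :=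
    (Finset.ext_iff.mp hu i).mpr (Finset.mem_univ i)
  simpa using hi

/-- A stochastic matrix with entries at least `η` contracts differences of coordinates by
`1 - η`. -/
theorem mulVec_sub_le_of_le {B : Matrix (Fin N) (Fin N) ℝ} {η : ℝ} (hη : 0 ≤ η)
    (hB : ∀ i j, η ≤ B i j) (hB1 : ∀ i, ∑ j, B i j = 1) {v : Fin N → ℝ} {d : ℝ}
    (hv : ∀ i j, v i - v j ≤ d) (i i' : Fin N) :
    ∑ j, B i j * v j - ∑ j, B i' j * v j ≤ (1 - η) * d := by
  -- At the minimizing coordinate `l` the difference `v j - v l` vanishes, and row `i` puts weight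
  -- at least `η` there.
  obtain ⟨l, -, hl⟩ := Finset.exists_min_image Finset.univ v ⟨i, Finset.mem_univ i⟩
  have hB0 : ∀ i j, 0 ≤ B i j := fun i j => hη.trans (hB i j)
  have h1 : v l ≤ ∑ j, B i' j * v j := by
    calc v l = ∑ j, B i' j * v l := by rw [← Finset.sum_mul, hB1, one_mul]
      _ ≤ _ := Finset.sum_le_sum fun j hj => mul_le_mul_of_nonneg_left (hl j hj) (hB0 _ _)
  have h2 : ∑ j, B i j * v j - v l ≤ (1 - B i l) * d := by
    calc ∑ j, B i j * v j - v l = ∑ j, B i j * (v j - v l) := by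
          simp only [mul_sub, Finset.sum_sub_distrib, ← Finset.sum_mul, hB1, one_mul]
      _ = ∑ j ∈ Finset.univ.erase l, B i j * (v j - v l) := by
          rw [← Finset.add_sum_erase _ _ (Finset.mem_univ l)]; simp
      _ ≤ ∑ j ∈ Finset.univ.erase l, B i j * d :=
          Finset.sum_le_sum fun j _ => mul_le_mul_of_nonneg_left (hv j l) (hB0 _ _)
      _ = (1 - B i l) * d := by
          rw [← Finset.sum_mul, ← hB1 i, ← Finset.add_sum_erase _ _ (Finset.mem_univ l)]; simp
  have hd : 0 ≤ d := by simpa using hv i i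
  have h3 : (1 - B i l) * d ≤ (1 - η) * d :=
    mul_le_mul_of_nonneg_right (by linarith [hB i l]) hd
  linarith

theorem exists_pow_eq_of_pos {L : ℕ} (hL : 0 < L) {ρ : ℝ} (h0 : 0 < ρ) (h1 : ρ < 1) :
    ∃ ξ : ℝ, 0 < ξ ∧ ξ < 1 ∧ ξ ^ L = ρ :=
  ⟨ρ ^ ((L : ℝ)⁻¹), Real.rpow_pos_of_pos h0 _,
    Real.rpow_lt_one h0.le h1 (by positivity), Real.rpow_inv_natCast_pow h0.le hL.ne'⟩

theorem NetworkAssumption.exists_geometric_spread {G : ℕ → Digraph (Fin N)}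
    (h : NetworkAssumption G A) (hN : 0 < N) :
    ∃ ϖ ξ η : ℝ, 0 < ϖ ∧ 0 < ξ ∧ ξ < 1 ∧ 0 < η ∧
      (∀ k n i i' j, transition A k n i j - transition A k n i' j ≤ ϖ * ξ ^ n) ∧
      ∃ L : ℕ, ∀ k i j, η ≤ transition A k L i j := by
  obtain ⟨L, hL, η, hη0, hη1, hη⟩ := h.exists_uniform_positive hN
  obtain ⟨ξ, hξ0, hξ1, hξ⟩ := exists_pow_eq_of_pos hL (sub_pos.mpr hη1) (by linarith)
  -- The factor `1 / ξ ^ L` makes the bound at least 1 for `n < L`, where only the trivial bound on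
  -- entries is available.
  refine ⟨1 / ξ ^ L, ξ, η, by positivity, hξ0, hξ1, hη0, fun k n => ?_, L, hη⟩
  induction n using Nat.strong_induction_on with
  | _ n ih =>
    intro i i' j
    have hsum := transition_row_sum h.row_sum
    have hnn := transition_nonneg h.nonneg
    rcases lt_or_ge n L with hn | hn
    · have hle : transition A k n i j ≤ 1 := by
        rw [← hsum k n i]
        exact Finset.single_le_sum (f := fun j => transition A k n i j)
          (fun l _ => hnn k n i l) (Finset.mem_univ j)
      have : 1 ≤ 1 / ξ ^ L * ξ ^ n := by
        rw [one_div_mul_eq_div, one_le_div (pow_pos hξ0 _)]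
        exact pow_le_pow_of_le_one hξ0.le hξ1.le hn.le
      linarith [hnn k n i' j]
    · obtain ⟨m, rfl⟩ := Nat.exists_eq_add_of_le' hn
      rw [transition_add, Matrix.mul_apply, Matrix.mul_apply]
      refine (mulVec_sub_le_of_le hη0.le (hη (k + m)) (hsum (k + m) L)
        (fun i i' => ih m (by omega) i i' j) i i').trans_eq ?_
      rw [← hξ, pow_add]; ring

/-- Absolute probability sequences exist under joint connectivity, with geometric mixing. -/
theorem NetworkAssumption.exists_isMixing {G : ℕ → Digraph (Fin N)}
    (h : NetworkAssumption G A) (hN : 0 < N) :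
    ∃ (p : ℕ → Fin N → ℝ) (pmin ϖ ξ : ℝ), IsMixing A p pmin ϖ ξ := by
  obtain ⟨ϖ, ξ, η, hϖ, hξ0, hξ1, hη, hspread, L, hL⟩ := h.exists_geometric_spread hN
  have hsum := transition_row_sum h.row_sum
  have hnn := transition_nonneg h.nonneg
  have hdist : ∀ k n m i i' j,
      |transition A k n i j - transition A k (n + m) i' j| ≤ ϖ * ξ ^ n := by
    intro k n m i i' j
    -- Each row of the longer product is a convex combination of rows of the shorter one.
    have hl : ∀ c : ℝ, c = ∑ l, transition A (k + n) m i' l * c := fun c => by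
      rw [← Finset.sum_mul, hsum, one_mul]
    rw [transition_add, Matrix.mul_apply, hl (transition A k n i j), ← Finset.sum_sub_distrib]
    refine (Finset.abs_sum_le_sum_abs _ _).trans ?_
    rw [hl (ϖ * ξ ^ n)]
    refine Finset.sum_le_sum fun l _ => ?_
    rw [← mul_sub, abs_mul, abs_of_nonneg (hnn _ _ _ _)]
    refine mul_le_mul_of_nonneg_left (abs_sub_le_iff.mpr ⟨hspread k n i l j, ?_⟩) (hnn _ _ _ _)
    exact hspread k n l i j
  have hgeom : Tendsto (fun n : ℕ => ϖ * ξ ^ n) atTop (𝓝 0) := by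
    simpa using (tendsto_pow_atTop_nhds_zero_of_lt_one hξ0.le hξ1).const_mul ϖ
  have hex : ∀ k j, ∃ l, Tendsto (fun n => transition A k n ⟨0, hN⟩ j) atTop (𝓝 l) := by
    intro k j
    refine cauchySeq_tendsto_of_complete (cauchySeq_of_le_tendsto_0' _ (fun n m hnm => ?_) hgeom)
    obtain ⟨m, rfl⟩ := Nat.exists_eq_add_of_le hnm
    exact hdist k n m _ _ j
  choose p hp using hex
  have hmix : ∀ k n i j, |transition A k n i j - p k j| ≤ ϖ * ξ ^ n := by
    intro k n i j
    have ht : Tendsto (fun m => |transition A k n i j - transition A k (n + m) ⟨0, hN⟩ j|) atTop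
        (𝓝 |transition A k n i j - p k j|) := by
      refine (tendsto_const_nhds.sub ?_).abs
      simpa only [add_comm n] using (tendsto_add_atTop_iff_nat n).mpr (hp k j)
    exact le_of_tendsto' ht fun m => hdist k n m i _ j
  have hlim : ∀ k i j, Tendsto (fun n => transition A k n i j) atTop (𝓝 (p k j)) := by
    intro k i j
    rw [tendsto_iff_norm_sub_tendsto_zero]
    exact squeeze_zero (fun _ => norm_nonneg _) (fun n => hmix k n i j) hgeom
  refine ⟨p, η, ϖ, ξ, ⟨fun k => ?_, hϖ, hξ0, hξ1, hmix, hη, fun k j => ?_, fun k => ?_⟩⟩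
  · have := tendsto_finsetSum Finset.univ fun j _ => hp k j
    simp only [hsum] at this
    exact tendsto_nhds_unique this tendsto_const_nhds |>.symm ▸ rfl
  · refine ge_of_tendsto ((tendsto_add_atTop_iff_nat L).mpr (hp k j))
      (Eventually.of_forall fun m => ?_)
    -- The earliest `L` factors stand on the right; averaging their rows keeps entries at least `η`.
    rw [add_comm, transition_add, Matrix.mul_apply]
    calc η = ∑ l, transition A (k + L) m ⟨0, hN⟩ l * η := by rw [← Finset.sum_mul, hsum, one_mul]
      _ ≤ _ := Finset.sum_le_sum fun l _ => mul_le_mul_of_nonneg_left (hL k l j) (hnn _ _ _ _)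
  · ext j
    have h1 : ∀ n i, transition A k (1 + n) i j = ∑ l, transition A (k + 1) n i l * A k l j := by
      intro n i
      rw [transition_add, Matrix.mul_apply]
      simp [transition]
    have h2 : Tendsto (fun n => transition A k (1 + n) ⟨0, hN⟩ j) atTop (𝓝 (p k j)) := by
      simpa only [add_comm 1] using (tendsto_add_atTop_iff_nat 1).mpr (hp k j)
    simp only [h1] at h2
    refine tendsto_nhds_unique h2 ?_
    exact tendsto_finsetSum Finset.univ fun l _ => (hp (k + 1) l).mul_const _

end Transition

end DKM

/-! ### Convex averages, geometric decay and relaxed nonexpansive steps -/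

namespace DKM

section Weighted

variable {E : Type*} [SeminormedAddCommGroup E] [NormedSpace ℝ E] {ι : Type*} [Fintype ι]

theorem sum_smul_sub_eq {w : ι → ℝ} (h1 : ∑ i, w i = 1) (v : ι → E) (z : E) :
    ∑ i, w i • v i - z = ∑ i, w i • (v i - z) := by
  simp only [smul_sub, Finset.sum_sub_distrib, ← Finset.sum_smul, h1, one_smul]

theorem norm_sum_smul_sub_le {w : ι → ℝ} (h0 : ∀ i, 0 ≤ w i) (h1 : ∑ i, w i = 1) (v : ι → E)
    (z : E) : ‖∑ i, w i • v i - z‖ ≤ ∑ i, w i * ‖v i - z‖ := by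
  rw [sum_smul_sub_eq h1]
  refine (norm_sum_le _ _).trans_eq (Finset.sum_congr rfl fun i _ => ?_)
  rw [norm_smul, Real.norm_of_nonneg (h0 i)]

theorem norm_sum_smul_sub_le_of_le {w : ι → ℝ} (h0 : ∀ i, 0 ≤ w i) (h1 : ∑ i, w i = 1)
    {v : ι → E} {z : E} {M : ℝ} (hM : ∀ i, ‖v i - z‖ ≤ M) : ‖∑ i, w i • v i - z‖ ≤ M := by
  calc _ ≤ ∑ i, w i * ‖v i - z‖ := norm_sum_smul_sub_le h0 h1 v z
    _ ≤ ∑ i, w i * M := Finset.sum_le_sum fun i _ => mul_le_mul_of_nonneg_left (hM i) (h0 i)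
    _ = M := by rw [← Finset.sum_mul, h1, one_mul]

theorem norm_sum_smul_sub_sq_le {w : ι → ℝ} (h0 : ∀ i, 0 ≤ w i) (h1 : ∑ i, w i = 1) (v : ι → E)
    (z : E) : ‖∑ i, w i • v i - z‖ ^ 2 ≤ ∑ i, w i * ‖v i - z‖ ^ 2 :=
  (pow_le_pow_left₀ (norm_nonneg _) (norm_sum_smul_sub_le h0 h1 v z) 2).trans
    (Real.pow_arith_mean_le_arith_mean_pow _ _ _ (fun i _ => h0 i) h1
      (fun _ _ => norm_nonneg _) 2)

end Weighted

/-- A sequence contracting by `ξ ^ L` over windows of length `L` decays like `ξ ^ n`. -/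
theorem le_geometric_of_window_contraction {u : ℕ → ℝ} {L : ℕ} {ξ : ℝ} (hL : 0 < L)
    (h0 : 0 < ξ) (h1 : ξ < 1) (hu : ∀ n, u (n + L) ≤ ξ ^ L * u n) :
    ∃ C : ℝ, 0 < C ∧ ∀ n, u n ≤ C * ξ ^ n := by
  set B := 1 + ∑ m ∈ Finset.range L, |u m| with hB
  have hBpos : 0 < B := by positivity
  refine ⟨B / ξ ^ L, by positivity, fun n => ?_⟩
  induction n using Nat.strong_induction_on with
  | _ n ih =>
    rcases lt_or_ge n L with hn | hn
    · have h2 : |u n| ≤ ∑ m ∈ Finset.range L, |u m| :=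
        Finset.single_le_sum (f := fun m => |u m|) (fun _ _ => abs_nonneg _)
          (Finset.mem_range.mpr hn)
      have h3 : 1 ≤ ξ ^ n / ξ ^ L := by
        rw [one_le_div (pow_pos h0 _)]
        exact pow_le_pow_of_le_one h0.le h1.le hn.le
      calc u n ≤ B * 1 := by linarith [le_abs_self (u n)]
        _ ≤ B * (ξ ^ n / ξ ^ L) := mul_le_mul_of_nonneg_left h3 hBpos.le
        _ = _ := by ring
    · obtain ⟨m, rfl⟩ := Nat.exists_eq_add_of_le' hn
      calc u (m + L) ≤ ξ ^ L * u m := hu m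
        _ ≤ ξ ^ L * (B / ξ ^ L * ξ ^ m) :=
          mul_le_mul_of_nonneg_left (ih m (by omega)) (pow_pos h0 _).le
        _ = _ := by rw [pow_add]; ring

/-- Geometric decay is faster than any power. -/
theorem pow_isBigO_one_div_rpow {r : ℝ} (h0 : 0 ≤ r) (h1 : r < 1) (c : ℝ) :
    (fun k : ℕ => r ^ k) =O[atTop] fun k : ℕ => 1 / (k : ℝ) ^ c := by
  obtain ⟨n, hn⟩ := exists_nat_ge c
  have ht := tendsto_pow_const_mul_const_pow_of_abs_lt_one n
    (show |r| < 1 by rwa [abs_of_nonneg h0])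
  have hb : ∀ᶠ k : ℕ in atTop, (k : ℝ) ^ n * r ^ k < 1 := ht.eventually_lt_const one_pos
  refine IsBigO.of_bound 1 ?_
  filter_upwards [hb, eventually_ge_atTop 1] with k hk hk1
  have hk1' : (1 : ℝ) ≤ k := by exact_mod_cast hk1
  have hpos : 0 < (k : ℝ) ^ c := Real.rpow_pos_of_pos (by linarith) c
  have hle : (k : ℝ) ^ c ≤ (k : ℝ) ^ n := by
    rw [← Real.rpow_natCast]
    exact Real.rpow_le_rpow_of_exponent_le hk1' hn
  rw [Real.norm_of_nonneg (by positivity), Real.norm_of_nonneg (by positivity), one_mul,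
    le_div_iff₀ hpos, mul_comm]
  exact (mul_le_mul_of_nonneg_right hle (by positivity)).trans hk.le

theorem commonFix_apply {X ι : Type*} {F : ι → X → X} {z : X} (hz : z ∈ commonFix F) (i : ι) :
    F i z = z := Set.mem_iInter.mp hz i

theorem isClosed_commonFix {X ι : Type*} [NormedAddCommGroup X] {F : ι → X → X} (hF : ∀ i, LipschitzWith 1 (F i)) :
    IsClosed (commonFix F) :=
  isClosed_iInter fun i => isClosed_fixedPoints (hF i).continuous

variable {H : Type*} [NormedAddCommGroup H] [InnerProductSpace ℝ H]

/-- A relaxed nonexpansive step decreases the squared distance to every fixed point. -/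
theorem norm_relaxed_sub_sq_le {f : H → H} (hf : LipschitzWith 1 f) {z : H} (hz : f z = z)
    {a : ℝ} (ha : 0 ≤ a) (y : H) :
    ‖y + a • (f y - y) - z‖ ^ 2 ≤ ‖y - z‖ ^ 2 - a * (1 - a) * ‖f y - y‖ ^ 2 := by
  have h1 : ‖f y - z‖ ≤ ‖y - z‖ := by
    have := hf.dist_le_mul y z
    rwa [hz, NNReal.coe_one, one_mul, dist_eq_norm, dist_eq_norm] at this
  have h2 : ‖f y - z‖ ^ 2 ≤ ‖y - z‖ ^ 2 := pow_le_pow_left₀ (norm_nonneg _) h1 2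
  have e1 : f y - z = (y - z) + (f y - y) := by abel
  have e2 : y + a • (f y - y) - z = (y - z) + a • (f y - y) := by abel
  -- Expanded, nonexpansiveness reads `2⟪y - z, f y - y⟫ + ‖f y - y‖² ≤ 0`, which controls the cross
  -- term below.
  rw [e1, norm_add_sq_real] at h2
  rw [e2, norm_add_sq_real, inner_smul_right, norm_smul, mul_pow, Real.norm_eq_abs, sq_abs]
  nlinarith

/-! ### Quantities attached to the iteration, and boundedness -/

section Iteration

variable {N : ℕ} {A : ℕ → Matrix (Fin N) (Fin N) ℝ} {F : Fin N → H → H}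
  {α : ℝ} {αs : ℕ → Fin N → ℝ} {x : ℕ → Fin N → H} {p : ℕ → Fin N → ℝ}

/-- The sum of the residuals `‖F i y - y‖` at the aggregates. -/
noncomputable def residual (F : Fin N → H → H) (A : ℕ → Matrix (Fin N) (Fin N) ℝ)
    (x : ℕ → Fin N → H) (k : ℕ) : ℝ :=
  ∑ i, ‖F i (aggregate A x k i) - aggregate A x k i‖

/-- The weighted mean of the agents' states. -/
noncomputable def weightedMean (p : ℕ → Fin N → ℝ) (x : ℕ → Fin N → H) (k : ℕ) : H :=
  ∑ i, p k i • x k i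

/-- The total deviation of the agents' states from their weighted mean. -/
noncomputable def disagreement (p : ℕ → Fin N → ℝ) (x : ℕ → Fin N → H) (k : ℕ) : ℝ :=
  ∑ i, ‖x k i - weightedMean p x k‖

/-- The weighted mean squared distance of the agents' states to a point. -/
noncomputable def weightedSq (p : ℕ → Fin N → ℝ) (x : ℕ → Fin N → H) (k : ℕ) (z : H) : ℝ :=
  ∑ i, p k i * ‖x k i - z‖ ^ 2

/-- The smallest weighted mean squared distance to a common fixed point. -/
noncomputable def weightedSqInf (F : Fin N → H → H) (p : ℕ → Fin N → ℝ) (x : ℕ → Fin N → H)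
    (k : ℕ) : ℝ :=
  sInf (weightedSq p x k '' commonFix F)

theorem residual_nonneg (k : ℕ) : 0 ≤ residual F A x k :=
  Finset.sum_nonneg fun _ _ => norm_nonneg _

theorem norm_le_residual (k : ℕ) (i : Fin N) :
    ‖F i (aggregate A x k i) - aggregate A x k i‖ ≤ residual F A x k :=
  Finset.single_le_sum (f := fun i => ‖F i (aggregate A x k i) - aggregate A x k i‖)
    (fun _ _ => norm_nonneg _) (Finset.mem_univ i)

theorem disagreement_nonneg (k : ℕ) : 0 ≤ disagreement p x k :=
  Finset.sum_nonneg fun _ _ => norm_nonneg _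

theorem norm_le_disagreement (k : ℕ) (i : Fin N) :
    ‖x k i - weightedMean p x k‖ ≤ disagreement p x k :=
  Finset.single_le_sum (f := fun i => ‖x k i - weightedMean p x k‖)
    (fun _ _ => norm_nonneg _) (Finset.mem_univ i)

theorem IsDKM.succ_eq (hx : IsDKM F A αs x) (k : ℕ) (i : Fin N) :
    x (k + 1) i = aggregate A x k i + αs k i • (F i (aggregate A x k i) - aggregate A x k i) := by
  simpa using hx k i

variable (hA0 : ∀ k i j, 0 ≤ A k i j) (hA1 : ∀ k i, ∑ j, A k i j = 1)
  (hF : ∀ i, LipschitzWith 1 (F i)) (hα0 : 0 < α)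
  (hαs : ∀ k i, αs k i ∈ Set.Icc α (1 - α)) (hx : IsDKM F A αs x)

include hA0 hA1 hF hα0 hαs hx in
-- Averaging and relaxed steps both preserve balls centred at a common fixed point.
theorem norm_sub_le_of_mem_commonFix {z : H} (hz : z ∈ commonFix F) {M : ℝ}
    (hM : ∀ i, ‖x 0 i - z‖ ≤ M) (k : ℕ) (i : Fin N) : ‖x k i - z‖ ≤ M := by
  induction k generalizing i with
  | zero => exact hM i
  | succ k ih =>
    have hagg : ‖aggregate A x k i - z‖ ≤ M :=
      norm_sum_smul_sub_le_of_le (hA0 k i) (hA1 k i) ih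
    have hstep := norm_relaxed_sub_sq_le (hF i) (commonFix_apply hz i)
      (hα0.le.trans (hαs k i).1) (aggregate A x k i)
    rw [← hx.succ_eq] at hstep
    refine le_trans ((sq_le_sq₀ (norm_nonneg _) (norm_nonneg _)).mp
      (hstep.trans (sub_le_self _ ?_))) hagg
    have := (hαs k i).1
    have := (hαs k i).2
    exact mul_nonneg (mul_nonneg (by linarith) (by linarith)) (sq_nonneg _)

end Iteration

end DKM

/-! ### Coupling of the distance and consensus recursions -/

namespace DKM

/-- With `δ = c / (2C)`, half of the decrease `c * D` absorbs `δ * C * D`. The other half, with a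
quarter of `δ * E`, pays for an extra `t * W'` on the left, `t` small. This leaves `W + 3/4 * δ *
E`, whence `s = 1 + t` and `ρ = max (1 / (1 + t)) (3 / 4)`. -/
theorem exists_lyapunov_weights {c C B : ℝ} (hc : 0 < c) (hC : 0 < C) (hB : 0 < B) :
    ∃ s δ ρ : ℝ, 1 ≤ s ∧ 0 < δ ∧ 0 < ρ ∧ ρ < 1 ∧
      ∀ W W' E E' D : ℝ, 0 ≤ W → 0 ≤ E → 0 ≤ D → W' ≤ W - c * D → E' ≤ E / 2 + C * D →
        W' ≤ B * (E + D) → s * W' + δ * E' ≤ ρ * (s * W + δ * E) := by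
  obtain ⟨t, ht0, ht1, ht2⟩ : ∃ t : ℝ, 0 < t ∧ t * B ≤ c / 2 ∧ t * B ≤ c / (2 * C) / 4 := by
    refine ⟨min (c / 2) (c / (2 * C) / 4) / B, by positivity, ?_, ?_⟩
    · rw [div_mul_cancel₀ _ hB.ne']; exact min_le_left _ _
    · rw [div_mul_cancel₀ _ hB.ne']; exact min_le_right _ _
  set δ := c / (2 * C) with hδ
  have hδ0 : 0 < δ := by positivity
  have hδC : δ * C = c / 2 := by rw [hδ]; field_simp
  have h1t : 0 < 1 + t := by linarith
  refine ⟨1 + t, δ, max (1 / (1 + t)) (3 / 4), by linarith, hδ0,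
    lt_max_of_lt_right (by norm_num), max_lt ?_ (by norm_num), ?_⟩
  · rw [div_lt_one h1t]; linarith
  · intro W W' E E' D hW hE hD h1 h2 h3
    have a1 : W ≤ max (1 / (1 + t)) (3 / 4) * ((1 + t) * W) := by
      calc W = 1 / (1 + t) * ((1 + t) * W) := by field_simp
        _ ≤ _ := mul_le_mul_of_nonneg_right (le_max_left _ _) (by positivity)
    have a2 : 3 / 4 * (δ * E) ≤ max (1 / (1 + t)) (3 / 4) * (δ * E) :=
      mul_le_mul_of_nonneg_right (le_max_right _ _) (by positivity)
    have a3 : δ * E' ≤ δ * E / 2 + c / 2 * D := by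
      have := mul_le_mul_of_nonneg_left h2 hδ0.le
      rw [← hδC]; linarith
    have a4 : t * W' ≤ δ / 4 * E + c / 2 * D := by
      have := mul_le_mul_of_nonneg_left h3 ht0.le
      have b1 := mul_le_mul_of_nonneg_right ht2 hE
      have b2 := mul_le_mul_of_nonneg_right ht1 hD
      linarith
    rw [mul_add]
    linarith

variable {H : Type*} [NormedAddCommGroup H] [InnerProductSpace ℝ H]
  {N : ℕ} {A : ℕ → Matrix (Fin N) (Fin N) ℝ} {F : Fin N → H → H}
  {α : ℝ} {αs : ℕ → Fin N → ℝ} {x : ℕ → Fin N → H} {p : ℕ → Fin N → ℝ} {pmin ϖ ξ χ κ : ℝ}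

theorem IsMixing.nonneg (hp : IsMixing A p pmin ϖ ξ) (k : ℕ) (i : Fin N) : 0 ≤ p k i :=
  hp.pmin_pos.le.trans (hp.pmin_le k i)

/-! ### Decay of the disagreement up to residuals -/

section Consensus

variable (hA0 : ∀ k i j, 0 ≤ A k i j) (hA1 : ∀ k i, ∑ j, A k i j = 1)
  (hα0 : 0 < α) (hαs : ∀ k i, αs k i ∈ Set.Icc α (1 - α)) (hx : IsDKM F A αs x)

include hA0 hA1 hα0 hαs hx in
/-- Over `n` steps the states follow the linear consensus dynamics up to the residuals. -/
theorem norm_sub_transition_le (k n : ℕ) (i : Fin N) :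
    ‖x (k + n) i - ∑ j, transition A k n i j • x k j‖ ≤
      ∑ m ∈ Finset.range n, residual F A x (k + m) := by
  induction n generalizing i with
  | zero => simp [transition, Matrix.one_apply]
  | succ n ih =>
    have e1 : ∑ j, transition A k (n + 1) i j • x k j =
        ∑ l, A (k + n) i l • ∑ j, transition A k n l j • x k j := by
      simp only [transition, Matrix.mul_apply, Finset.sum_smul, Finset.smul_sum, mul_smul]
      exact Finset.sum_comm
    have e2 : x (k + (n + 1)) i - ∑ j, transition A k (n + 1) i j • x k j =
        (∑ l, A (k + n) i l • (x (k + n) l - ∑ j, transition A k n l j • x k j) - 0) +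
          αs (k + n) i • (F i (aggregate A x (k + n) i) - aggregate A x (k + n) i) := by
      rw [e1, ← add_assoc, hx.succ_eq]
      simp only [smul_sub, Finset.sum_sub_distrib, aggregate]
      abel
    rw [e2, Finset.sum_range_succ]
    refine (norm_add_le _ _).trans (add_le_add ?_ ?_)
    · exact norm_sum_smul_sub_le_of_le (hA0 _ i) (hA1 _ i) fun l => by
        rw [sub_zero]; exact ih l
    · have h1 := (hαs (k + n) i).1
      have h2 := (hαs (k + n) i).2
      rw [norm_smul, Real.norm_of_nonneg (by linarith)]
      exact (mul_le_of_le_one_left (norm_nonneg _) (by linarith)).trans (norm_le_residual _ i)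

include hA0 hA1 hα0 hαs hx in
-- All new states are compared with the old mean; the new mean, a convex combination of them, is
-- equally close to it, which gives the factor 2.
theorem disagreement_add_le (hp : IsMixing A p pmin ϖ ξ) (k n : ℕ) :
    disagreement p x (k + n) ≤
      2 * N * (ϖ * ξ ^ n * disagreement p x k +
        ∑ m ∈ Finset.range n, residual F A x (k + m)) := by
  set M := ϖ * ξ ^ n * disagreement p x k + ∑ m ∈ Finset.range n, residual F A x (k + m) with hM
  have h1 : ∀ i, ‖x (k + n) i - weightedMean p x k‖ ≤ M := by
    intro i
    -- Both weight vectors sum to 1, so the mean may be subtracted from every state.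
    have e : ∑ j, transition A k n i j • x k j - weightedMean p x k =
        ∑ j, (transition A k n i j - p k j) • (x k j - weightedMean p x k) := by
      simp only [sub_smul, Finset.sum_sub_distrib]
      rw [← sum_smul_sub_eq (transition_row_sum hA1 k n i),
        ← sum_smul_sub_eq (hp.sum_eq_one k)]
      simp only [weightedMean]
      abel
    have h2 : ‖∑ j, transition A k n i j • x k j - weightedMean p x k‖ ≤
        ϖ * ξ ^ n * disagreement p x k := by
      rw [e, disagreement, Finset.mul_sum]
      refine (norm_sum_le _ _).trans (Finset.sum_le_sum fun j _ => ?_)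
      rw [norm_smul]
      exact mul_le_mul_of_nonneg_right (hp.mixing k n i j) (norm_nonneg _)
    calc ‖x (k + n) i - weightedMean p x k‖ ≤
          ‖x (k + n) i - ∑ j, transition A k n i j • x k j‖ +
            ‖∑ j, transition A k n i j • x k j - weightedMean p x k‖ :=
          norm_sub_le_norm_sub_add_norm_sub _ _ _
      _ ≤ M := by
        have := norm_sub_transition_le hA0 hA1 hα0 hαs hx k n i
        linarith
  have h2 : ‖weightedMean p x (k + n) - weightedMean p x k‖ ≤ M :=
    norm_sum_smul_sub_le_of_le (hp.nonneg _) (hp.sum_eq_one _) h1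
  calc disagreement p x (k + n) ≤ ∑ _i : Fin N, 2 * M := by
        refine Finset.sum_le_sum fun i _ => ?_
        refine (norm_sub_le_norm_sub_add_norm_sub _ (weightedMean p x k) _).trans ?_
        rw [norm_sub_rev (weightedMean p x k)]
        linarith [h1 i]
    _ = 2 * N * M := by simp; ring

include hA0 hA1 hα0 hαs hx in
theorem exists_disagreement_window (hp : IsMixing A p pmin ϖ ξ) (hN : 0 < N) :
    ∃ L : ℕ, 0 < L ∧ ∀ k, disagreement p x (k + L) ^ 2 ≤ disagreement p x k ^ 2 / 2 +
      8 * N ^ 2 * L * ∑ m ∈ Finset.range L, residual F A x (k + m) ^ 2 := by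
  have hNR : (0 : ℝ) < N := Nat.cast_pos.mpr hN
  have hϖ := hp.ϖ_pos
  obtain ⟨n, hn⟩ := exists_pow_lt_of_lt_one (show 0 < 1 / (4 * N * ϖ) by positivity) hp.ξ_lt_one
  have hn' : 2 * N * ϖ * ξ ^ (n + 1) ≤ 1 / 2 := by
    have h1 : ξ ^ (n + 1) ≤ ξ ^ n := pow_le_pow_of_le_one hp.ξ_pos.le hp.ξ_lt_one.le n.le_succ
    calc 2 * N * ϖ * ξ ^ (n + 1) ≤ 2 * N * ϖ * (1 / (4 * N * ϖ)) :=
          mul_le_mul_of_nonneg_left (h1.trans hn.le) (by positivity)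
      _ = 1 / 2 := by field_simp; norm_num
  refine ⟨n + 1, n.succ_pos, fun k => ?_⟩
  have h1 := disagreement_add_le hA0 hA1 hα0 hαs hx hp k (n + 1)
  set S := ∑ m ∈ Finset.range (n + 1), residual F A x (k + m) with hS
  have h2 : S ^ 2 ≤ ((n + 1 : ℕ) : ℝ) *
      ∑ m ∈ Finset.range (n + 1), residual F A x (k + m) ^ 2 := by
    simpa using sq_sum_le_card_mul_sum_sq (s := Finset.range (n + 1))
      (f := fun m => residual F A x (k + m))
  have he := disagreement_nonneg (p := p) (x := x) k
  have h3 : disagreement p x (k + (n + 1)) ≤ disagreement p x k / 2 + 2 * N * S := by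
    have := mul_le_mul_of_nonneg_right hn' he
    linarith
  have h4 := pow_le_pow_left₀ (disagreement_nonneg (p := p) (x := x) (k + (n + 1))) h3 2
  have h5 := mul_le_mul_of_nonneg_left h2 (show (0 : ℝ) ≤ 8 * N ^ 2 by positivity)
  -- This is `(a + b)² ≤ 2a² + 2b²`; the factor `L` in the claim comes from Cauchy–Schwarz in `h2`.
  nlinarith [sq_nonneg (disagreement p x k / 2 - 2 * N * S)]

end Consensus

/-! ### Fejér monotonicity, regularity and linear convergence -/

section Fejer

variable (hA0 : ∀ k i j, 0 ≤ A k i j) (hA1 : ∀ k i, ∑ j, A k i j = 1)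
  (hF : ∀ i, LipschitzWith 1 (F i))
  (hα0 : 0 < α) (hαs : ∀ k i, αs k i ∈ Set.Icc α (1 - α)) (hx : IsDKM F A αs x)

include hA0 hA1 hF hα0 hαs hx in
-- Averaging by `A k` under the weights `p (k + 1)` yields the weights `p k`, so the consensus step
-- does not increase the weighted square and the relaxed step decreases it.
theorem weightedSq_succ_le (hp : IsMixing A p pmin ϖ ξ) {z : H} (hz : z ∈ commonFix F)
    (k : ℕ) :
    weightedSq p x (k + 1) z ≤
      weightedSq p x k z - pmin * α ^ 2 / N * residual F A x k ^ 2 := by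
  set r : Fin N → ℝ := fun i => ‖F i (aggregate A x k i) - aggregate A x k i‖ with hr
  have h1 : ∀ i, ‖x (k + 1) i - z‖ ^ 2 ≤
      ∑ j, A k i j * ‖x k j - z‖ ^ 2 - α ^ 2 * r i ^ 2 := by
    intro i
    have hagg : ‖aggregate A x k i - z‖ ^ 2 ≤ _ :=
      norm_sum_smul_sub_sq_le (hA0 k i) (hA1 k i) (x k) z
    have hstep := norm_relaxed_sub_sq_le (hF i) (commonFix_apply hz i)
      (hα0.le.trans (hαs k i).1) (aggregate A x k i)
    rw [← hx.succ_eq] at hstep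
    have g1 := (hαs k i).1
    have g2 := (hαs k i).2
    -- Both `αs k i` and `1 - αs k i` are at least `α`.
    have h2 : α ^ 2 * r i ^ 2 ≤ αs k i * (1 - αs k i) * r i ^ 2 :=
      mul_le_mul_of_nonneg_right (by nlinarith) (sq_nonneg _)
    linarith
  have h2 : ∑ i, p (k + 1) i * ∑ j, A k i j * ‖x k j - z‖ ^ 2 = weightedSq p x k z := by
    simp only [Finset.mul_sum, weightedSq]
    rw [Finset.sum_comm]
    refine Finset.sum_congr rfl fun j _ => ?_
    rw [hp.backward k, Matrix.vecMul, dotProduct, Finset.sum_mul]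
    exact Finset.sum_congr rfl fun i _ => by ring
  have h3 : residual F A x k ^ 2 ≤ N * ∑ i, r i ^ 2 := by
    change (∑ i, r i) ^ 2 ≤ _
    simpa using sq_sum_le_card_mul_sum_sq (s := Finset.univ) (f := r)
  have h4 : pmin * α ^ 2 / N * residual F A x k ^ 2 ≤ ∑ i, p (k + 1) i * (α ^ 2 * r i ^ 2) := by
    rcases Nat.eq_zero_or_pos N with rfl | hN
    · simp
    have hNR : (0 : ℝ) < N := Nat.cast_pos.mpr hN
    have hpm := hp.pmin_pos
    calc pmin * α ^ 2 / N * residual F A x k ^ 2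
        ≤ pmin * α ^ 2 / N * (N * ∑ i, r i ^ 2) := mul_le_mul_of_nonneg_left h3 (by positivity)
      _ = ∑ i, pmin * (α ^ 2 * r i ^ 2) := by
        rw [← mul_assoc, div_mul_cancel₀ _ hNR.ne', Finset.mul_sum]
        simp only [mul_assoc]
      _ ≤ _ := Finset.sum_le_sum fun i _ =>
        mul_le_mul_of_nonneg_right (hp.pmin_le _ i) (by positivity)
  calc weightedSq p x (k + 1) z ≤
        ∑ i, p (k + 1) i * (∑ j, A k i j * ‖x k j - z‖ ^ 2 - α ^ 2 * r i ^ 2) :=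
        Finset.sum_le_sum fun i _ => mul_le_mul_of_nonneg_left (h1 i) (hp.nonneg _ i)
    _ ≤ _ := by
      simp only [mul_sub, Finset.sum_sub_distrib] at h2 ⊢
      linarith

include hA0 hA1 hF hα0 hαs hx in
theorem weightedSq_add_le (hp : IsMixing A p pmin ϖ ξ) {z : H} (hz : z ∈ commonFix F)
    (k n : ℕ) :
    weightedSq p x (k + n) z ≤ weightedSq p x k z -
      pmin * α ^ 2 / N * ∑ m ∈ Finset.range n, residual F A x (k + m) ^ 2 := by
  induction n with
  | zero => simp
  | succ n ih =>
    have := weightedSq_succ_le hA0 hA1 hF hα0 hαs hx hp hz (k + n)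
    rw [Finset.sum_range_succ, mul_add, ← add_assoc]
    linarith

omit [InnerProductSpace ℝ H] in
theorem weightedSq_nonneg (hp : IsMixing A p pmin ϖ ξ) (k : ℕ) (z : H) :
    0 ≤ weightedSq p x k z :=
  Finset.sum_nonneg fun i _ => mul_nonneg (hp.nonneg k i) (sq_nonneg _)

omit [InnerProductSpace ℝ H] in
theorem bddBelow_weightedSq (hp : IsMixing A p pmin ϖ ξ) (k : ℕ) :
    BddBelow (weightedSq p x k '' commonFix F) :=
  ⟨0, Set.forall_mem_image.mpr fun z _ => weightedSq_nonneg hp k z⟩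

omit [InnerProductSpace ℝ H] in
theorem weightedSqInf_nonneg (hp : IsMixing A p pmin ϖ ξ) (k : ℕ) :
    0 ≤ weightedSqInf F p x k :=
  Real.sInf_nonneg (Set.forall_mem_image.mpr fun z _ => weightedSq_nonneg hp k z)

include hA0 hA1 hF hα0 hαs hx in
-- The decrease does not depend on `z`, so it survives the infimum.
theorem weightedSqInf_add_le (hp : IsMixing A p pmin ϖ ξ) (hne : (commonFix F).Nonempty)
    (k n : ℕ) :
    weightedSqInf F p x (k + n) ≤ weightedSqInf F p x k -
      pmin * α ^ 2 / N * ∑ m ∈ Finset.range n, residual F A x (k + m) ^ 2 := by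
  rw [le_sub_iff_add_le]
  refine le_csInf (hne.image _) (Set.forall_mem_image.mpr fun z hz => ?_)
  have h1 : weightedSqInf F p x (k + n) ≤ weightedSq p x (k + n) z :=
    csInf_le (bddBelow_weightedSq hp _) (Set.mem_image_of_mem _ hz)
  have h2 := weightedSq_add_le hA0 hA1 hF hα0 hαs hx hp hz k n
  linarith

include hA0 hA1 hF in
-- Regularity is applied at a state, while residuals are measured at aggregates. Moving the point
-- and its image each cost twice the disagreement, for each of the `N` operators.
theorem infDist_le_of_regular (hreg : IsRegularityConstant F x χ κ) (k : ℕ) (i : Fin N) :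
    Metric.infDist (x k i) (commonFix F) ≤
      κ * (4 * N * disagreement p x k + residual F A x k) := by
  refine (hreg.regular _ (by simpa using hreg.norm_le k i)).trans
    (mul_le_mul_of_nonneg_left ?_ hreg.κ_pos.le)
  have h1 : ∀ j, ‖x k i - aggregate A x k j‖ ≤ 2 * disagreement p x k := by
    intro j
    have ha : ‖aggregate A x k j - weightedMean p x k‖ ≤ disagreement p x k :=
      norm_sum_smul_sub_le_of_le (hA0 k j) (hA1 k j) (norm_le_disagreement k)
    refine (norm_sub_le_norm_sub_add_norm_sub _ (weightedMean p x k) _).trans ?_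
    rw [norm_sub_rev (weightedMean p x k)]
    linarith [norm_le_disagreement (p := p) (x := x) k i]
  calc ∑ j, ‖x k i - F j (x k i)‖ ≤ ∑ j, (4 * disagreement p x k +
        ‖F j (aggregate A x k j) - aggregate A x k j‖) := by
        refine Finset.sum_le_sum fun j _ => ?_
        have h2 : ‖F j (aggregate A x k j) - F j (x k i)‖ ≤ 2 * disagreement p x k := by
          have := (hF j).dist_le_mul (aggregate A x k j) (x k i)
          rw [NNReal.coe_one, one_mul, dist_eq_norm, dist_eq_norm,
            norm_sub_rev (aggregate A x k j)] at this
          exact this.trans (h1 j)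
        have e : x k i - F j (x k i) = (x k i - aggregate A x k j) +
            (F j (aggregate A x k j) - F j (x k i)) -
            (F j (aggregate A x k j) - aggregate A x k j) := by abel
        rw [e]
        refine (norm_sub_le _ _).trans ?_
        have := norm_add_le (x k i - aggregate A x k j) (F j (aggregate A x k j) - F j (x k i))
        linarith [h1 j]
    _ = _ := by
      rw [Finset.sum_add_distrib, residual]
      simp
      ring

include hA0 hA1 hF in
-- One fixed point near the state of `i₀` serves all agents, whose states lie within `2 * e` of that
-- state.
theorem weightedSqInf_le_of_regular (hp : IsMixing A p pmin ϖ ξ) (hN : 0 < N)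
    (hne : (commonFix F).Nonempty) (hreg : IsRegularityConstant F x χ κ) (k : ℕ) :
    weightedSqInf F p x k ≤ 2 * ((2 + 4 * N * κ) ^ 2 + κ ^ 2) *
      (disagreement p x k ^ 2 + residual F A x k ^ 2) := by
  set e := disagreement p x k with he
  set δ := residual F A x k with hδ
  have he0 : 0 ≤ e := disagreement_nonneg k
  set i₀ : Fin N := ⟨0, hN⟩
  have h1 : ∀ t, Metric.infDist (x k i₀) (commonFix F) < t →
      weightedSqInf F p x k ≤ (2 * e + t) ^ 2 := by
    intro t ht
    obtain ⟨z, hz, hzt⟩ := (Metric.infDist_lt_iff hne).mp ht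
    rw [dist_eq_norm] at hzt
    refine (csInf_le (bddBelow_weightedSq hp _) (Set.mem_image_of_mem _ hz)).trans ?_
    have h2 : ∀ i, ‖x k i - z‖ ≤ 2 * e + t := by
      intro i
      have e1 : x k i - z = (x k i - weightedMean p x k) - (x k i₀ - weightedMean p x k) +
        (x k i₀ - z) := by abel
      rw [e1]
      refine (norm_add_le _ _).trans ?_
      have := norm_sub_le (x k i - weightedMean p x k) (x k i₀ - weightedMean p x k)
      linarith [norm_le_disagreement (p := p) (x := x) k i,
        norm_le_disagreement (p := p) (x := x) k i₀]
    calc weightedSq p x k z ≤ ∑ i, p k i * (2 * e + t) ^ 2 :=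
          Finset.sum_le_sum fun i _ => mul_le_mul_of_nonneg_left
            (pow_le_pow_left₀ (norm_nonneg _) (h2 i) 2) (hp.nonneg k i)
      _ = _ := by rw [← Finset.sum_mul, hp.sum_eq_one, one_mul]
  -- Letting `t` decrease to the distance avoids needing a nearest point.
  have h2 : weightedSqInf F p x k ≤
      (2 * e + Metric.infDist (x k i₀) (commonFix F)) ^ 2 := by
    have hc : Continuous fun t : ℝ => (2 * e + t) ^ 2 := by fun_prop
    exact ge_of_tendsto ((hc.tendsto _).mono_left nhdsWithin_le_nhds)
      ((eventually_mem_nhdsWithin (s := Set.Ioi _)).mono fun t ht => h1 t ht)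
  have h3 : 2 * e + Metric.infDist (x k i₀) (commonFix F) ≤ (2 + 4 * N * κ) * e + κ * δ := by
    have := infDist_le_of_regular (p := p) hA0 hA1 hF hreg k i₀
    linarith
  have h4 := pow_le_pow_left₀
    (add_nonneg (mul_nonneg zero_le_two he0) Metric.infDist_nonneg) h3 2
  set b := 2 + 4 * N * κ
  nlinarith [sq_nonneg (b * e - κ * δ), mul_nonneg (sq_nonneg b) (sq_nonneg δ),
    mul_nonneg (sq_nonneg κ) (sq_nonneg e)]

include hA0 hA1 hF hα0 hαs hx in
theorem weightedSqInf_le_geometric (hp : IsMixing A p pmin ϖ ξ) (hN : 0 < N)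
    (hne : (commonFix F).Nonempty) (hreg : IsRegularityConstant F x χ κ) :
    ∃ C q : ℝ, 0 < C ∧ 0 < q ∧ q < 1 ∧ ∀ k, weightedSqInf F p x k ≤ C * q ^ k := by
  have hNR : (0 : ℝ) < N := Nat.cast_pos.mpr hN
  obtain ⟨L, hL, hwin⟩ := exists_disagreement_window hA0 hA1 hα0 hαs hx hp hN
  have hLR : (0 : ℝ) < L := Nat.cast_pos.mpr hL
  have hpm := hp.pmin_pos
  have hκ := hreg.κ_pos
  obtain ⟨s, δ, ρ, hs, hδ, hρ0, hρ1, hcontr⟩ := exists_lyapunov_weights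
    (c := pmin * α ^ 2 / N) (C := 8 * (N : ℝ) ^ 2 * L)
    (B := 2 * ((2 + 4 * N * κ) ^ 2 + κ ^ 2)) (by positivity) (by positivity) (by positivity)
  obtain ⟨q, hq0, hq1, hq⟩ := exists_pow_eq_of_pos hL hρ0 hρ1
  have hW0 := fun k => weightedSqInf_nonneg (F := F) (x := x) hp k
  have hstep : ∀ k, s * weightedSqInf F p x (k + L) + δ * disagreement p x (k + L) ^ 2 ≤
      q ^ L * (s * weightedSqInf F p x k + δ * disagreement p x k ^ 2) := by
    intro k
    rw [hq]
    have hmono := weightedSqInf_add_le hA0 hA1 hF hα0 hαs hx hp hne k L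
    have hD : 0 ≤ ∑ m ∈ Finset.range L, residual F A x (k + m) ^ 2 :=
      Finset.sum_nonneg fun _ _ => sq_nonneg _
    have hres : residual F A x k ^ 2 ≤ ∑ m ∈ Finset.range L, residual F A x (k + m) ^ 2 :=
      Finset.single_le_sum (f := fun m => residual F A x (k + m) ^ 2) (a := 0)
        (fun _ _ => sq_nonneg _) (Finset.mem_range.mpr hL)
    have hcD := mul_nonneg (show 0 ≤ pmin * α ^ 2 / N by positivity) hD
    have hreg' := weightedSqInf_le_of_regular hA0 hA1 hF hp hN hne hreg k
    have hB := mul_le_mul_of_nonneg_left hres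
      (show 0 ≤ 2 * ((2 + 4 * N * κ) ^ 2 + κ ^ 2) by positivity)
    -- The bound on the later infimum follows from monotonicity and regularity at time `k`, whose
    -- residual is the first term of the window sum.
    refine hcontr _ _ _ _ _ (hW0 k) (sq_nonneg _) hD hmono (hwin k) ?_
    rw [mul_add] at hreg' ⊢
    linarith
  obtain ⟨C, hC, hle⟩ := le_geometric_of_window_contraction
    (u := fun k => s * weightedSqInf F p x k + δ * disagreement p x k ^ 2) hL hq0 hq1 hstep
  refine ⟨C, q, hC, hq0, hq1, fun k => le_trans ?_ (hle k)⟩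
  have := mul_le_mul_of_nonneg_right hs (hW0 k)
  have := mul_nonneg hδ.le (sq_nonneg (disagreement p x k))
  linarith

include hA0 hA1 hF hα0 hαs hx in
/-- The error-free iteration converges linearly to a common fixed point; no bound on the
relaxation parameters beyond `αs k i ∈ [α, 1 - α]` is needed. -/
theorem exists_limit_geometric [CompleteSpace H] (hp : IsMixing A p pmin ϖ ξ) (hN : 0 < N)
    (hne : (commonFix F).Nonempty) (hreg : IsRegularityConstant F x χ κ) :
    ∃ xstar ∈ commonFix F, ∃ C r : ℝ, 0 < r ∧ r < 1 ∧
      ∀ k i, ‖x k i - xstar‖ ≤ C * r ^ k := by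
  obtain ⟨C, q, hC, hq0, hq1, hW⟩ :=
    weightedSqInf_le_geometric hA0 hA1 hF hα0 hαs hx hp hN hne hreg
  have hpm := hp.pmin_pos
  -- `C + 1` leaves the strict room needed to pick a near-minimizer.
  have hex : ∀ k, ∃ z ∈ commonFix F, weightedSq p x k z < (C + 1) * q ^ k := by
    intro k
    have hlt : weightedSqInf F p x k < (C + 1) * q ^ k :=
      (hW k).trans_lt (mul_lt_mul_of_pos_right (by linarith) (pow_pos hq0 k))
    obtain ⟨_, ⟨z, hz, rfl⟩, h⟩ := exists_lt_of_csInf_lt (hne.image _) hlt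
    exact ⟨z, hz, h⟩
  choose z hz hzlt using hex
  set r := √q with hr
  have hr0 : 0 < r := Real.sqrt_pos.mpr hq0
  have hr1 : r < 1 := by rw [hr, Real.sqrt_lt' one_pos]; simpa using hq1
  set B := √((C + 1) / pmin) with hB
  -- The single point `z k` controls all later times by Fejér monotonicity; the square root turns
  -- the rate `q` into `r`.
  have hnear : ∀ k n i, ‖x (k + n) i - z k‖ ≤ B * r ^ k := by
    intro k n i
    have hpos : 0 ≤ B * r ^ k := by positivity
    rw [← sq_le_sq₀ (norm_nonneg _) hpos, mul_pow, ← pow_mul, mul_comm k 2, pow_mul, hB, hr,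
      Real.sq_sqrt (by positivity), Real.sq_sqrt hq0.le, div_mul_eq_mul_div, le_div_iff₀ hpm]
    calc ‖x (k + n) i - z k‖ ^ 2 * pmin ≤ p (k + n) i * ‖x (k + n) i - z k‖ ^ 2 := by
          rw [mul_comm]
          exact mul_le_mul_of_nonneg_right (hp.pmin_le _ i) (sq_nonneg _)
      _ ≤ weightedSq p x (k + n) (z k) :=
          Finset.single_le_sum (f := fun i => p (k + n) i * ‖x (k + n) i - z k‖ ^ 2)
            (fun i _ => mul_nonneg (hp.nonneg _ i) (sq_nonneg _)) (Finset.mem_univ i)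
      _ ≤ weightedSq p x k (z k) := by
          refine (weightedSq_add_le hA0 hA1 hF hα0 hαs hx hp (hz k) k n).trans (sub_le_self _ ?_)
          exact mul_nonneg (by positivity) (Finset.sum_nonneg fun _ _ => sq_nonneg _)
      _ ≤ _ := (hzlt k).le
  set i₀ : Fin N := ⟨0, hN⟩
  have hgeom : ∀ c : ℝ, Tendsto (fun k : ℕ => c * r ^ k) atTop (𝓝 0) := fun c => by
    simpa using (tendsto_pow_atTop_nhds_zero_of_lt_one hr0.le hr1).const_mul c
  obtain ⟨xs, hxs⟩ : ∃ xs, Tendsto (fun k => x k i₀) atTop (𝓝 xs) := by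
    refine cauchySeq_tendsto_of_complete
      (cauchySeq_of_le_tendsto_0' (fun k => 2 * B * r ^ k) (fun k m hkm => ?_) (hgeom _))
    obtain ⟨m, rfl⟩ := Nat.exists_eq_add_of_le hkm
    rw [dist_eq_norm]
    refine (norm_sub_le_norm_sub_add_norm_sub _ (z k) _).trans ?_
    rw [norm_sub_rev (z k)]
    have h0 : ‖x k i₀ - z k‖ ≤ B * r ^ k := hnear k 0 i₀
    linarith [hnear k m i₀]
  have hzx : ∀ k, ‖xs - z k‖ ≤ B * r ^ k := fun k => by
    have h1 : Tendsto (fun n => x (k + n) i₀) atTop (𝓝 xs) := by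
      simpa only [add_comm k] using (tendsto_add_atTop_iff_nat k).mpr hxs
    exact le_of_tendsto' (h1.sub_const (z k)).norm fun n => hnear k n i₀
  refine ⟨xs, ?_, 2 * B, r, hr0, hr1, fun k i => ?_⟩
  · refine (isClosed_commonFix hF).mem_of_tendsto (f := z) (b := atTop) ?_
      (Eventually.of_forall hz)
    rw [tendsto_iff_norm_sub_tendsto_zero]
    exact squeeze_zero (fun _ => norm_nonneg _)
      (fun k => by rw [norm_sub_rev]; exact hzx k) (hgeom B)
  · refine (norm_sub_le_norm_sub_add_norm_sub _ (z k) _).trans ?_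
    rw [norm_sub_rev (z k)]
    have h0 : ‖x k i - z k‖ ≤ B * r ^ k := hnear k 0 i
    linarith [hzx k]

include hA0 hA1 hF hα0 hαs hx in
theorem exists_isRegularityConstant (hreg : BoundedlyPowerRegular F) :
    ∃ χ κ : ℝ, IsRegularityConstant F x χ κ := by
  obtain ⟨z, hz⟩ := hreg.1
  set M := ∑ i, ‖x 0 i - z‖ with hM
  have hM0 : 0 ≤ M := Finset.sum_nonneg fun _ _ => norm_nonneg _
  have hbd := norm_sub_le_of_mem_commonFix hA0 hA1 hF hα0 hαs hx hz (M := M) fun i =>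
    Finset.single_le_sum (f := fun i => ‖x 0 i - z‖) (fun _ _ => norm_nonneg _)
      (Finset.mem_univ i)
  obtain ⟨κ, hκ0, hκ⟩ := hreg.2 (Metric.closedBall 0 (M + ‖z‖ + 1)) Metric.isBounded_closedBall
  refine ⟨M + ‖z‖ + 1, κ + 1, by positivity, fun k i => ?_, by positivity, fun y hy => ?_⟩
  · have := norm_le_norm_sub_add (x k i) z
    linarith [hbd k i]
  · exact (hκ y hy).trans (mul_le_mul_of_nonneg_right (by linarith)
      (Finset.sum_nonneg fun _ _ => norm_nonneg _))

end Fejer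

end DKM

theorem theorem3 {H : Type*} [NormedAddCommGroup H] [InnerProductSpace ℝ H] [CompleteSpace H]
    (N : ℕ) (hN : 0 < N)
    (G : ℕ → Digraph (Fin N)) (A : ℕ → Matrix (Fin N) (Fin N) ℝ)
    (hGA : DKM.NetworkAssumption G A)
    (F : Fin N → H → H) (hF : ∀ i, LipschitzWith 1 (F i))
    (hreg : DKM.BoundedlyPowerRegular F)
    (α : ℝ) (hα : α ∈ Set.Ioc (0 : ℝ) (1 / 2))
    (αs : ℕ → Fin N → ℝ) (hαs : ∀ k i, αs k i ∈ Set.Icc α (1 - α))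
    (x : ℕ → Fin N → H) (hx : DKM.IsDKM F A αs x) :
    (∃ (p : ℕ → Fin N → ℝ) (pmin ϖ ξ : ℝ), DKM.IsMixing A p pmin ϖ ξ) ∧
    (∃ χ κ : ℝ, DKM.IsRegularityConstant F x χ κ) ∧
    ∀ (p : ℕ → Fin N → ℝ) (pmin ϖ ξ χ κ : ℝ),
      DKM.IsMixing A p pmin ϖ ξ →
      DKM.IsRegularityConstant F x χ κ →
      DKM.StepCondition αs α pmin ϖ ξ (Real.sqrt N * κ) →
      ∃ xstar ∈ DKM.commonFix F, ∀ i,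
        Tendsto (fun k => x k i) atTop (𝓝 xstar) ∧
        (fun k => x k i - xstar) =O[atTop]
          (fun k : ℕ => 1 / (k : ℝ) ^ Real.log (1 / ξ)) := by
  have hA0 := hGA.nonneg
  have hA1 := hGA.row_sum
  refine ⟨hGA.exists_isMixing hN,
    DKM.exists_isRegularityConstant hA0 hA1 hF hα.1 hαs hx hreg, ?_⟩
  intro p pmin ϖ ξ χ κ hp hκ _
  obtain ⟨xstar, hmem, C, r, hr0, hr1, hle⟩ :=
    DKM.exists_limit_geometric hA0 hA1 hF hα.1 hαs hx hp hN hreg.1 hκ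
  refine ⟨xstar, hmem, fun i => ⟨?_, ?_⟩⟩
  · rw [tendsto_iff_norm_sub_tendsto_zero]
    refine squeeze_zero (fun _ => norm_nonneg _) (fun k => hle k i) ?_
    simpa using (tendsto_pow_atTop_nhds_zero_of_lt_one hr0.le hr1).const_mul C
  -- The rate `r` is not tied to `ξ`: geometric decay dominates any power, whatever the exponent.
  · refine IsBigO.trans (IsBigO.of_bound C (Eventually.of_forall fun k => ?_))
      (DKM.pow_isBigO_one_div_rpow hr0.le hr1 _)
    rw [Real.norm_of_nonneg (pow_nonneg hr0.le k)]
    exact hle k i
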